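/- Let $G$ be a finite simple graph without isolated vertices, with vertex set $V_G$ and edge set $E_G$, and let $K$ be a field. Let $K[V_G]=K[x_i : i\in V_G]$ and $K[E_G]=K[t_e : e\in E_G]$ be the standard graded polynomial rings on the vertices and on the edges, let $\theta\colon K[E_G]\to K[V_G]$ be the $K$-algebra homomorphism with $\theta(t_e)=x_ix_j$ for every edge $e=\{i,j\}$, and let $$I(X_G)=\theta^{-1}\bigl((x_i^2-x_j^2 : i,j\in V_G)\bigr),$$ a homogeneous ideal of $K[E_G]$. A join of $G$ is a set of edges $J\subseteq E_G$ such that $|J\cap E_C|\le |E_C|/2$ for every circuit (cycle) $C$ of $G$, where $E_C$ is the set of edges of $C$; let $\mu(G)$ be the maximum cardinality of a join of $G$. For a nonzero finitely generated graded module $M$ over a polynomial ring over $K$ in finitely many variables, with graded Betti numbers $\beta_{ij}(M)$ (the number of generators of degree $j$ of the $i$-th free module in a minimal graded free resolution of $M$), let $\operatorname{reg} M=\max\{j-i : \beta_{ij}(M)\neq 0\}$ be its Castelnuovo--Mumford regularity; for the zero ideal the convention $\operatorname{reg}(0)=1$ is used, in agreement with $\operatorname{reg} I=\operatorname{reg}(K[E_G]/I)+1$.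 Then $$\operatorname{reg} I(X_G)\ \ge\ \mu(G).$$ -/

import Mathlib

noncomputable section

namespace JoinReg

/-! ### Graded free resolutions over a polynomial ring and regularity -/

/-- Let `F` be the free module with basis `b`, the basis element `b` being placed in degree
`deg b`, over the standard graded polynomial ring. A vector is homogeneous of degree `j` when
each of its coordinates `v b` is homogeneous of degree `j - deg b` (and `0` if `j < deg b`). -/
def IsFreeHomogeneous {σ K ι : Type*} [Field K] (deg : ι → ℕ) (j : ℕ)
    (v : ι → MvPolynomial σ K) : Prop :=
  ∀ b, ∀ m ∈ (v b).support, deg b + m.degree = j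

/-- A minimal graded free resolution
`⋯ → F₂ → F₁ → F₀ → M → 0`
(with finitely generated `Fᵢ`) of an `ℕ`-graded module `M` over the polynomial ring `K[σ]`;
`ℳ j` is the component of degree `j` of `M`. Here `Fᵢ = ⨁_b K[σ](-deg i b)`. -/
structure MinimalGradedFreeResolution {σ K M : Type*} [Field K] [AddCommGroup M]
    [Module (MvPolynomial σ K) M] (ℳ : ℕ → AddSubgroup M) where
  /-- the rank of `Fᵢ` -/
  rank : ℕ → ℕ
  /-- the degrees of the basis elements of `Fᵢ` -/
  deg : ∀ i, Fin (rank i) → ℕ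
  /-- the differential `Fᵢ₊₁ → Fᵢ` -/
  d : ∀ i, (Fin (rank (i + 1)) → MvPolynomial σ K) →ₗ[MvPolynomial σ K]
    (Fin (rank i) → MvPolynomial σ K)
  /-- the augmentation `F₀ → M` -/
  ε : (Fin (rank 0) → MvPolynomial σ K) →ₗ[MvPolynomial σ K] M
  /-- the differentials are homogeneous of degree `0` -/
  d_deg : ∀ i b, IsFreeHomogeneous (deg i) (deg (i + 1) b) (d i (Pi.single b 1))
  /-- the augmentation is homogeneous of degree `0` -/
  ε_deg : ∀ b, ε (Pi.single b 1) ∈ ℳ (deg 0 b)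
  ε_surjective : Function.Surjective ε
  exact_zero : Function.Exact (d 0) ε
  exact_succ : ∀ i, Function.Exact (d (i + 1)) (d i)
  /-- minimality: the image of `Fᵢ₊₁ → Fᵢ` is contained in `𝔪 Fᵢ`, where `𝔪` is the ideal
  generated by the variables -/
  minimal : ∀ i v b, MvPolynomial.constantCoeff (d i v b) = 0

/-- The number of basis elements of degree `j` in the `i`-th free module. -/
def MinimalGradedFreeResolution.betti {σ K M : Type*} [Field K] [AddCommGroup M]
    [Module (MvPolynomial σ K) M] {ℳ : ℕ → AddSubgroup M}
    (F : MinimalGradedFreeResolution (σ := σ) (K := K) ℳ) (i j : ℕ) : ℕ :=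
  Nat.card {b : Fin (F.rank i) // F.deg i b = j}

open Classical in
/-- The graded Betti number `β_{ij}(M)`, read off a minimal graded free resolution of `M`.
Such a resolution exists and is unique up to isomorphism for a finitely generated graded module
over a polynomial ring in finitely many variables; the value `0` is used if there is none. -/
def gradedBetti (σ K : Type*) {M : Type*} [Field K] [AddCommGroup M]
    [Module (MvPolynomial σ K) M] (ℳ : ℕ → AddSubgroup M) (i j : ℕ) : ℕ :=
  if h : Nonempty (MinimalGradedFreeResolution (σ := σ) (K := K) ℳ) then
    (Classical.choice h).betti i j
  else 0

/-- Castelnuovo--Mumford regularity: `reg M = max {j - i : β_{ij}(M) ≠ 0}`. -/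
def regularity (σ K : Type*) {M : Type*} [Field K] [AddCommGroup M]
    [Module (MvPolynomial σ K) M] (ℳ : ℕ → AddSubgroup M) : EReal :=
  ⨆ (i : ℕ) (j : ℕ) (_ : gradedBetti σ K ℳ i j ≠ 0), (((j : ℝ) - (i : ℝ) : ℝ) : EReal)

/-- The grading of an ideal by degree: its elements that are homogeneous of degree `j`. -/
def idealGrading {σ K : Type*} [Field K] (I : Ideal (MvPolynomial σ K)) (j : ℕ) :
    AddSubgroup I :=
  (MvPolynomial.homogeneousSubmodule σ K j).toAddSubgroup.comap I.subtype.toAddMonoidHom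

open Classical in
/-- The regularity of a homogeneous ideal `I`, viewed as a graded module. For `I = 0`, which has
no nonzero Betti number, the convention is `reg 0 = 1`, so that `reg I = reg (K[σ]/I) + 1` holds
for every proper homogeneous ideal. -/
def idealRegularity {σ K : Type*} [Field K] (I : Ideal (MvPolynomial σ K)) : EReal :=
  if I = ⊥ then 1 else regularity σ K (idealGrading I)

/-! ### The ideal of a graph -/

/-- `θ : K[E_G] → K[V_G]`, `t_e ↦ x_i x_j` for `e = {i, j}`. -/
def theta {V : Type*} (K : Type*) [Field K] (G : SimpleGraph V) :
    MvPolynomial G.edgeSet K →ₐ[K] MvPolynomial V K :=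
  MvPolynomial.aeval fun e : G.edgeSet =>
    Sym2.lift ⟨fun i j => (MvPolynomial.X i * MvPolynomial.X j : MvPolynomial V K),
      fun _ _ => mul_comm _ _⟩ (e : Sym2 V)

/-- `I(X_G) = θ⁻¹ (x_i² - x_j² : i, j ∈ V_G)`. -/
def graphIdeal {V : Type*} (K : Type*) [Field K] (G : SimpleGraph V) :
    Ideal (MvPolynomial G.edgeSet K) :=
  (Ideal.span {p : MvPolynomial V K |
    ∃ i j : V, p = MvPolynomial.X i ^ 2 - MvPolynomial.X j ^ 2}).comap (theta K G)

/-! ### Joins -/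

open Classical in
/-- A join: a set of edges that contains at most half of the edges of each circuit. -/
def IsJoin {V : Type*} (G : SimpleGraph V) (J : Finset (Sym2 V)) : Prop :=
  (J : Set (Sym2 V)) ⊆ G.edgeSet ∧
    ∀ (v : V) (c : G.Walk v v), c.IsCycle → 2 * (J ∩ c.edges.toFinset).card ≤ c.length

/-- The maximum vertex join number: the maximum cardinality of a join. -/
def maxJoinNumber {V : Type*} (G : SimpleGraph V) : ℕ :=
  sSup {k : ℕ | ∃ J : Finset (Sym2 V), IsJoin G J ∧ J.card = k}

end JoinReg

end

/-! Put S = K[E_G], I = I(X_G) and s = |E_G|. Sending x_i to the class (1, e_i) maps K[V_G] to the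
group algebra of ℤ × (ℤ/2)^V, with kernel generated by the x_i² - x_j². Hence I is the kernel of the
map sending t_e, for e = {i, j}, to the class (2, e_i + e_j) (`mem_graphIdeal_iff`). Variables
become units of the group algebra, so each t_e is regular modulo I. Every t_f² - t_e² lies in I, so
I + (t_e) contains the squares of all variables.

Let J be a join and e ∈ J. The monomial t^(J \ e) is not in I + (t_e)
(`IsJoin.edgeMonomial_notMem`): otherwise some monomial divisible by t_e would have the same class.
Its set B of odd exponents would differ from J \ e by an even edge set, which splits into cycles;
the join inequality then makes |B|, and hence the degree, too large. As squares vanish modulo I +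
(t_e), some multiple of t^(J \ e) is a socle monomial, of degree n ≥ |J| - 1.

A socle element modulo a regular variable is visible at the end of a resolution.
`exists_socle_element` transports it along the complex one variable at a time, the homological index
and the degree each rising by one, with exactness modulo the variables used supplied by
`exists_lift_varSubmodule`. After all variables are used, the vector lies outside 𝔪F and forces a
basis element of degree n + s - 1 in homological degree s - 2 of a resolution of I. So reg I ≥ n + 1
≥ |J|. This needs s ≥ 2; joins with at most one edge are treated separately. -/

noncomputable section

namespace JoinReg

open MvPolynomial

/-! ### Homogeneous components in graded free modules -/

section GradedFree

variable {σ K ι κ : Type*} [Field K]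

/-- The component of degree `j` of a vector in the graded free module with basis degrees `deg`. -/
def freeComponent (deg : ι → ℕ) (j : ℕ) (v : ι → MvPolynomial σ K) : ι → MvPolynomial σ K :=
  fun b => if deg b ≤ j then homogeneousComponent (j - deg b) (v b) else 0

lemma coeff_freeComponent (deg : ι → ℕ) (j : ℕ) (v : ι → MvPolynomial σ K) (b : ι) (m : σ →₀ ℕ) :
    coeff m (freeComponent deg j v b) = if deg b + m.degree = j then coeff m (v b) else 0 := by
  unfold freeComponent
  by_cases h : deg b ≤ j
  · rw [if_pos h, coeff_homogeneousComponent]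
    exact if_congr (by omega) rfl rfl
  · rw [if_neg h, if_neg (by omega), coeff_zero]

lemma freeComponent_add (deg : ι → ℕ) (j : ℕ) (v w : ι → MvPolynomial σ K) :
    freeComponent deg j (v + w) = freeComponent deg j v + freeComponent deg j w := by
  ext b m
  simp only [Pi.add_apply, coeff_add, coeff_freeComponent]
  split_ifs <;> simp

lemma freeComponent_zero (deg : ι → ℕ) (j : ℕ) :
    freeComponent deg j (0 : ι → MvPolynomial σ K) = 0 := by
  ext b m
  simp [coeff_freeComponent]

lemma isFreeHomogeneous_freeComponent (deg : ι → ℕ) (j : ℕ) (v : ι → MvPolynomial σ K) :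
    IsFreeHomogeneous deg j (freeComponent deg j v) := by
  intro b m hm
  rw [mem_support_iff, coeff_freeComponent] at hm
  by_contra h
  exact hm (if_neg h)

lemma IsFreeHomogeneous.freeComponent_eq {deg : ι → ℕ} {j : ℕ} {v : ι → MvPolynomial σ K}
    (hv : IsFreeHomogeneous deg j v) (k : ℕ) :
    freeComponent deg k v = if j = k then v else 0 := by
  ext b m
  rw [coeff_freeComponent]
  by_cases h0 : coeff m (v b) = 0
  · by_cases hk : j = k <;> simp [hk, h0]
  · have := hv b m (mem_support_iff.2 h0)
    by_cases hk : j = k <;> simp [this, hk]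

lemma IsFreeHomogeneous.freeComponent_self {deg : ι → ℕ} {j : ℕ} {v : ι → MvPolynomial σ K}
    (hv : IsFreeHomogeneous deg j v) : freeComponent deg j v = v := by
  rw [hv.freeComponent_eq, if_pos rfl]

lemma IsFreeHomogeneous.monomial_smul {deg : ι → ℕ} {j : ℕ} {v : ι → MvPolynomial σ K}
    (hv : IsFreeHomogeneous deg j v) (m : σ →₀ ℕ) (c : K) :
    IsFreeHomogeneous deg (j + m.degree) (monomial m c • v) := by
  classical
  intro b n hn
  rw [Pi.smul_apply, smul_eq_mul, mem_support_iff, coeff_monomial_mul'] at hn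
  by_cases h : m ≤ n
  · rw [if_pos h] at hn
    have := hv b _ (mem_support_iff.2 (right_ne_zero_of_mul hn))
    have h2 : n.degree = (n - m).degree + m.degree := by
      rw [← map_add, tsub_add_cancel_of_le h]
    omega
  · exact absurd (if_neg h) hn

lemma isFreeHomogeneous_single [DecidableEq ι] (deg : ι → ℕ) (b : ι) :
    IsFreeHomogeneous deg (deg b) (Pi.single b (1 : MvPolynomial σ K)) := by
  classical
  intro b' m hm
  rw [mem_support_iff] at hm
  by_cases h : b' = b
  · subst h
    rw [Pi.single_eq_same, coeff_one] at hm
    by_cases h0 : 0 = m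
    · simp [← h0]
    · exact absurd (if_neg h0) hm
  · simp [Pi.single_eq_of_ne h] at hm

lemma sum_freeComponent [Finite ι] (deg : ι → ℕ) (v : ι → MvPolynomial σ K) :
    ∃ N, ∑ j ∈ Finset.range N, freeComponent deg j v = v := by
  classical
  cases nonempty_fintype ι
  refine ⟨(∑ b, ∑ m ∈ (v b).support, (deg b + m.degree)) + 1, ?_⟩
  ext b m
  rw [Finset.sum_apply, coeff_sum]
  simp only [coeff_freeComponent]
  rw [Finset.sum_ite_eq]
  by_cases h0 : coeff m (v b) = 0
  · simp [h0]
  · rw [if_pos]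
    rw [Finset.mem_range, Nat.lt_succ_iff]
    calc deg b + m.degree ≤ ∑ m ∈ (v b).support, (deg b + m.degree) :=
          Finset.single_le_sum (f := fun m : σ →₀ ℕ => deg b + m.degree)
            (fun _ _ => Nat.zero_le _) (mem_support_iff.2 h0)
      _ ≤ _ := Finset.single_le_sum (f := fun b => ∑ m ∈ (v b).support, (deg b + m.degree))
            (fun _ _ => Nat.zero_le _) (Finset.mem_univ b)

/-- Vectors of a finite free module are sums of monomial multiples of basis vectors. -/
lemma free_induction [Finite ι] [DecidableEq ι] {P : (ι → MvPolynomial σ K) → Prop}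
    (v : ι → MvPolynomial σ K) (h0 : P 0) (hadd : ∀ v w, P v → P w → P (v + w))
    (hm : ∀ (b : ι) (m : σ →₀ ℕ) (c : K),
      P ((monomial m c : MvPolynomial σ K) • (Pi.single b 1 : ι → MvPolynomial σ K))) : P v := by
  cases nonempty_fintype ι
  have key : ∀ s : Finset ι, P (∑ b ∈ s, v b • (Pi.single b 1 : ι → MvPolynomial σ K)) := by
    intro s
    induction s using Finset.induction_on with
    | empty => simpa using h0
    | insert b s hb ih =>
      rw [Finset.sum_insert hb]
      refine hadd _ _ ?_ ih
      induction v b using MvPolynomial.induction_on' with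
      | monomial m c => exact hm b m c
      | add p q hp hq => rw [add_smul]; exact hadd _ _ hp hq
  have := key Finset.univ
  rwa [← pi_eq_sum_univ' v] at this

/-- Both sides are additive, so it suffices to compare them on monomial multiples of basis vectors.
This is what makes kernels of graded maps homogeneous. -/
lemma freeComponent_map [Finite ι] [DecidableEq ι] (deg : ι → ℕ) (deg' : κ → ℕ)
    (d : (ι → MvPolynomial σ K) →ₗ[MvPolynomial σ K] (κ → MvPolynomial σ K))
    (hd : ∀ b, IsFreeHomogeneous deg' (deg b) (d (Pi.single b 1))) (j : ℕ)
    (v : ι → MvPolynomial σ K) :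
    freeComponent deg' j (d v) = d (freeComponent deg j v) := by
  induction v using free_induction with
  | h0 => rw [map_zero, freeComponent_zero, freeComponent_zero, map_zero]
  | hadd v w hv hw =>
    rw [map_add, freeComponent_add, freeComponent_add, map_add, hv, hw]
  | hm b m c =>
    rw [map_smul, ((hd b).monomial_smul m c).freeComponent_eq,
      ((isFreeHomogeneous_single deg b).monomial_smul m c).freeComponent_eq]
    split_ifs
    · rw [map_smul]
    · rw [map_zero]

/-- A submodule of a graded free module is homogeneous if it contains the components of its
elements. -/
def IsHomogeneousSubmodule (deg : ι → ℕ)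
    (N : Submodule (MvPolynomial σ K) (ι → MvPolynomial σ K)) : Prop :=
  ∀ v ∈ N, ∀ j, freeComponent deg j v ∈ N

lemma isHomogeneousSubmodule_ker [Finite ι] [DecidableEq ι] {deg : ι → ℕ} {deg' : κ → ℕ}
    {d : (ι → MvPolynomial σ K) →ₗ[MvPolynomial σ K] (κ → MvPolynomial σ K)}
    (hd : ∀ b, IsFreeHomogeneous deg' (deg b) (d (Pi.single b 1))) :
    IsHomogeneousSubmodule deg (LinearMap.ker d) := by
  intro v hv j
  rw [LinearMap.mem_ker] at hv ⊢
  rw [← freeComponent_map deg deg' d hd, hv, freeComponent_zero]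

/-- `v` is a family of homogeneous generators of `N` with degrees `deg'`. -/
def IsHomogeneousGenerators (deg : ι → ℕ)
    (N : Submodule (MvPolynomial σ K) (ι → MvPolynomial σ K)) (k : ℕ) (deg' : Fin k → ℕ)
    (v : Fin k → ι → MvPolynomial σ K) : Prop :=
  (∀ b, IsFreeHomogeneous deg (deg' b) (v b)) ∧
    Submodule.span (MvPolynomial σ K) (Set.range v) = N

lemma exists_isHomogeneousGenerators [Finite σ] [Finite ι] {deg : ι → ℕ}
    {N : Submodule (MvPolynomial σ K) (ι → MvPolynomial σ K)} (hN : IsHomogeneousSubmodule deg N) :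
    ∃ k deg' v, IsHomogeneousGenerators deg N k deg' v := by
  classical
  obtain ⟨s, hs⟩ := (inferInstance : IsNoetherian (MvPolynomial σ K) (ι → MvPolynomial σ K)).noetherian N
  choose B hB using fun v : ι → MvPolynomial σ K => sum_freeComponent deg v
  let T := Σ x : s, Fin (B x)
  let e : Fin (Fintype.card T) ≃ T := (Fintype.equivFin T).symm
  refine ⟨Fintype.card T, fun b => (e b).2, fun b => freeComponent deg (e b).2 (e b).1,
    fun b => isFreeHomogeneous_freeComponent _ _ _, le_antisymm ?_ ?_⟩
  · rw [Submodule.span_le]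
    rintro _ ⟨b, rfl⟩
    exact hN _ (hs ▸ Submodule.subset_span (e b).1.2) _
  · conv_lhs => rw [← hs]
    rw [Submodule.span_le]
    intro x hx
    rw [SetLike.mem_coe, ← hB x]
    refine Submodule.sum_mem _ fun j hj => Submodule.subset_span ?_
    refine ⟨e.symm ⟨⟨x, hx⟩, ⟨j, Finset.mem_range.1 hj⟩⟩, ?_⟩
    dsimp only
    rw [Equiv.apply_symm_apply]

/-- The linear map sending the `b`-th basis vector to `v b`. -/
abbrev generatorMap {k : ℕ} (v : Fin k → ι → MvPolynomial σ K) :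
    (Fin k → MvPolynomial σ K) →ₗ[MvPolynomial σ K] (ι → MvPolynomial σ K) :=
  Fintype.linearCombination (MvPolynomial σ K) v

/-- Take the least possible number of homogeneous generators. A relation with a nonzero constant
coefficient would make one generator redundant. -/
lemma exists_minimal_generators [Finite σ] [Finite ι] {deg : ι → ℕ}
    {N : Submodule (MvPolynomial σ K) (ι → MvPolynomial σ K)} (hN : IsHomogeneousSubmodule deg N) :
    ∃ (k : ℕ) (deg' : Fin k → ℕ)
      (d : (Fin k → MvPolynomial σ K) →ₗ[MvPolynomial σ K] (ι → MvPolynomial σ K)),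
      (∀ b, IsFreeHomogeneous deg (deg' b) (d (Pi.single b 1))) ∧ LinearMap.range d = N ∧
        ∀ c, d c = 0 → ∀ b, constantCoeff (c b) = 0 := by
  classical
  have hex := exists_isHomogeneousGenerators hN
  obtain ⟨deg', v, hv, hspan⟩ := Nat.find_spec hex
  have hmin := fun k (hk : k < Nat.find hex) => Nat.find_min hex hk
  generalize Nat.find hex = k at deg' v hv hspan hmin
  have hd : ∀ b, IsFreeHomogeneous deg (deg' b) (generatorMap v (Pi.single b 1)) := by
    intro b
    rw [Fintype.linearCombination_apply_single, one_smul]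
    exact hv b
  refine ⟨k, deg', generatorMap v, hd, ?_, ?_⟩
  · rw [Fintype.range_linearCombination, hspan]
  · intro c hc b₀
    by_contra hne
    obtain _ | k := k
    · exact b₀.elim0
    have hc' : generatorMap v (freeComponent deg' (deg' b₀) c) = 0 := by
      rw [← freeComponent_map deg' deg _ hd, hc, freeComponent_zero]
    rw [Fintype.linearCombination_apply, Fin.sum_univ_succAbove _ b₀] at hc'
    -- In total degree `deg' b₀` the coordinate at `b₀` has polynomial degree 0, so it is a unit and
    -- the relation can be solved for `v b₀`.
    have hb₀ : freeComponent deg' (deg' b₀) c b₀ = C (constantCoeff (c b₀)) := by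
      rw [freeComponent, if_pos le_rfl, Nat.sub_self, homogeneousComponent_zero]
      rfl
    rw [hb₀] at hc'
    have hmem : v b₀ ∈ Submodule.span (MvPolynomial σ K) (Set.range (v ∘ b₀.succAbove)) := by
      have h1 : v b₀ = (C (constantCoeff (c b₀))⁻¹ : MvPolynomial σ K) •
          ((C (constantCoeff (c b₀)) : MvPolynomial σ K) • v b₀) := by
        rw [smul_smul, ← C_mul, inv_mul_cancel₀ hne, C_1, one_smul]
      rw [h1, eq_neg_of_add_eq_zero_left hc']
      refine Submodule.smul_mem _ _ (Submodule.neg_mem _ (Submodule.sum_mem _ fun i _ => ?_))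
      exact Submodule.smul_mem _ _ (Submodule.subset_span ⟨i, rfl⟩)
    refine hmin k (Nat.lt_succ_self k) ⟨deg' ∘ b₀.succAbove, v ∘ b₀.succAbove, fun b => hv _, ?_⟩
    rw [← hspan]
    refine le_antisymm (Submodule.span_mono (Set.range_comp_subset_range _ _)) ?_
    rw [Submodule.span_le]
    rintro _ ⟨b, rfl⟩
    rcases Fin.eq_self_or_eq_succAbove b₀ b with h | ⟨i, h⟩
    · rw [h]; exact hmem
    · rw [h]; exact Submodule.subset_span ⟨i, rfl⟩

end GradedFree

/-! ### Existence of minimal graded free resolutions -/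

section Existence

variable (σ K : Type*) [Field K]

/-- A homogeneous submodule of a finitely generated graded free module, the next syzygy module to
be resolved. -/
structure SyzygyStage where
  rank : ℕ
  deg : Fin rank → ℕ
  syz : Submodule (MvPolynomial σ K) (Fin rank → MvPolynomial σ K)
  homogeneous : IsHomogeneousSubmodule deg syz

variable {σ K} [Finite σ]

/-- The number of minimal generators of a syzygy module. -/
def SyzygyStage.nextRank (s : SyzygyStage σ K) : ℕ :=
  (exists_minimal_generators s.homogeneous).choose

/-- The degrees of minimal generators of a syzygy module. -/
def SyzygyStage.nextDeg (s : SyzygyStage σ K) : Fin s.nextRank → ℕ :=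
  (exists_minimal_generators s.homogeneous).choose_spec.choose

/-- The presentation of a syzygy module by minimal generators. -/
def SyzygyStage.map (s : SyzygyStage σ K) : (Fin s.nextRank → MvPolynomial σ K)
    →ₗ[MvPolynomial σ K] (Fin s.rank → MvPolynomial σ K) :=
  (exists_minimal_generators s.homogeneous).choose_spec.choose_spec.choose

lemma SyzygyStage.map_deg (s : SyzygyStage σ K) (b : Fin s.nextRank) :
    IsFreeHomogeneous s.deg (s.nextDeg b) (s.map (Pi.single b 1)) :=
  (exists_minimal_generators s.homogeneous).choose_spec.choose_spec.choose_spec.1 b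

lemma SyzygyStage.range_map (s : SyzygyStage σ K) : LinearMap.range s.map = s.syz :=
  (exists_minimal_generators s.homogeneous).choose_spec.choose_spec.choose_spec.2.1

lemma SyzygyStage.constantCoeff_eq_zero (s : SyzygyStage σ K)
    (c : Fin s.nextRank → MvPolynomial σ K) (hc : s.map c = 0) (b : Fin s.nextRank) :
    constantCoeff (c b) = 0 :=
  (exists_minimal_generators s.homogeneous).choose_spec.choose_spec.choose_spec.2.2 c hc b

/-- The stage given by the kernel of the minimal presentation. -/
def SyzygyStage.next (s : SyzygyStage σ K) : SyzygyStage σ K where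
  rank := s.nextRank
  deg := s.nextDeg
  syz := LinearMap.ker s.map
  homogeneous := isHomogeneousSubmodule_ker s.map_deg

/-- The iterated syzygy stages. -/
def SyzygyStage.iterate (s : SyzygyStage σ K) : ℕ → SyzygyStage σ K
  | 0 => s
  | i + 1 => (s.iterate i).next

/-- The stage given by a homogeneous ideal in the free module of rank one. -/
def idealStage (I : Ideal (MvPolynomial σ K))
    (hI : ∀ f ∈ I, ∀ j, homogeneousComponent j f ∈ I) : SyzygyStage σ K where
  rank := 1
  deg := fun _ => 0
  syz := Submodule.comap (LinearMap.proj 0) I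
  homogeneous := by
    intro v hv j
    simpa [freeComponent] using hI _ hv j

/-- Iterating minimal presentations of syzygies gives the resolution. Existence matters because
`gradedBetti` defaults to 0. Stage 0 is the ideal inside S, so the i-th free module is that of stage
i + 1. -/
theorem nonempty_minimalGradedFreeResolution (I : Ideal (MvPolynomial σ K))
    (hI : ∀ f ∈ I, ∀ j, homogeneousComponent j f ∈ I) :
    Nonempty (MinimalGradedFreeResolution (σ := σ) (K := K) (idealGrading I)) := by
  let s := (idealStage I hI).iterate
  let z : Fin (idealStage I hI).rank := (0 : Fin 1)
  have hmem : ∀ v, (idealStage I hI).map v z ∈ I := fun v => by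
    have : (idealStage I hI).map v ∈ (idealStage I hI).syz := by
      rw [← (idealStage I hI).range_map]
      exact LinearMap.mem_range_self _ v
    exact this
  let ε : (Fin (s 1).rank → MvPolynomial σ K) →ₗ[MvPolynomial σ K] I :=
    ((LinearMap.proj z).comp (idealStage I hI).map).codRestrict I hmem
  have hε : ∀ v, ε v = 0 ↔ (s 0).map v = 0 := by
    intro v
    rw [← Subtype.coe_inj]
    refine ⟨fun h => ?_, fun h => ?_⟩
    · funext b
      have hb : b = z := Subsingleton.elim (α := Fin 1) b 0
      rw [hb]
      exact h
    · exact congrFun h z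
  have hrange : ∀ i v, v ∈ Set.range (s (i + 1)).map ↔ (s i).map v = 0 := by
    intro i v
    rw [← LinearMap.coe_range, (s (i + 1)).range_map]
    exact Iff.rfl
  refine ⟨⟨fun i => (s (i + 1)).rank, fun i => (s (i + 1)).deg, fun i => (s (i + 1)).map, ε,
    fun i b => (s (i + 1)).map_deg b, fun b => ?_, fun x => ?_, fun y => ?_, fun i y => ?_,
    fun i v b => ?_⟩⟩
  · intro m hm
    have := (s 0).map_deg b z m (mem_support_iff.2 hm)
    have hw : Finsupp.weight (1 : σ → ℕ) m = m.degree :=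
      (DFunLike.congr_fun Finsupp.degree_eq_weight_one m).symm
    rw [hw]
    exact (zero_add _).symm.trans this
  · have hx : (fun _ => (x : MvPolynomial σ K)) ∈ (idealStage I hI).syz := x.2
    rw [← (idealStage I hI).range_map] at hx
    obtain ⟨v, hv⟩ := hx
    exact ⟨v, Subtype.ext (congrFun hv z)⟩
  · rw [hε]; exact (hrange 0 y).symm
  · exact (hrange (i + 1) y).symm
  · exact (s i).constantCoeff_eq_zero _ ((hrange i _).1 ⟨v, rfl⟩) b

end Existence

/-! ### Socle elements and the last free module of a resolution -/

section Socle

variable {σ K : Type*} [Field K]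

/-- The vectors whose coordinates lie in the ideal generated by the variables in `A`. -/
def varSubmodule (K ι : Type*) [Field K] (A : Set σ) :
    Submodule (MvPolynomial σ K) (ι → MvPolynomial σ K) :=
  Submodule.pi Set.univ fun _ => Ideal.span (X '' A)

variable {ι κ : Type*} {A : Set σ}

lemma mem_varSubmodule {x : ι → MvPolynomial σ K} :
    x ∈ varSubmodule K ι A ↔ ∀ b, ∀ m ∈ (x b).support, ∃ i ∈ A, m i ≠ 0 := by
  simp only [varSubmodule, Submodule.mem_pi, Set.mem_univ, true_imp_iff]
  exact forall_congr' fun b => mem_ideal_span_X_image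

lemma map_mem_varSubmodule [Finite ι] {x : ι → MvPolynomial σ K} (hx : x ∈ varSubmodule K ι A)
    (d : (ι → MvPolynomial σ K) →ₗ[MvPolynomial σ K] (κ → MvPolynomial σ K)) :
    d x ∈ varSubmodule K κ A := by
  simp only [varSubmodule, Submodule.mem_pi, Set.mem_univ, true_imp_iff] at hx ⊢
  exact Ideal.map_pi _ x hx d

lemma varSubmodule_mono {B : Set σ} (h : A ⊆ B) :
    varSubmodule K ι A ≤ varSubmodule K ι B := fun x hx => by
  rw [mem_varSubmodule] at hx ⊢
  exact fun b m hm => let ⟨i, hi, h0⟩ := hx b m hm; ⟨i, h hi, h0⟩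

lemma X_smul_mem_varSubmodule {i : σ} (hi : i ∈ A) (x : ι → MvPolynomial σ K) :
    (X i : MvPolynomial σ K) • x ∈ varSubmodule K ι A := by
  simp only [varSubmodule, Submodule.mem_pi, Set.mem_univ, true_imp_iff]
  exact fun b => Ideal.mul_mem_right _ _ (Ideal.subset_span ⟨i, hi, rfl⟩)

lemma exists_of_mem_varSubmodule_insert {i : σ} {x : ι → MvPolynomial σ K}
    (hx : x ∈ varSubmodule K ι (insert i A)) :
    ∃ f, ∃ a ∈ varSubmodule K ι A, x = (X i : MvPolynomial σ K) • f + a := by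
  simp only [varSubmodule, Submodule.mem_pi, Set.mem_univ, true_imp_iff, Set.image_insert_eq,
    Ideal.mem_span_insert] at hx ⊢
  choose f a ha hx using hx
  refine ⟨f, a, ha, funext fun b => ?_⟩
  rw [hx b, Pi.add_apply, Pi.smul_apply, smul_eq_mul, mul_comm]

/-- `X i` is regular modulo a monomial ideal generated by other variables: raising the exponent of
`i` introduces no variable of `A`. -/
lemma mem_varSubmodule_of_X_smul_mem {i : σ} (hi : i ∉ A) {x : ι → MvPolynomial σ K}
    (hx : (X i : MvPolynomial σ K) • x ∈ varSubmodule K ι A) : x ∈ varSubmodule K ι A := by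
  rw [mem_varSubmodule] at hx ⊢
  intro b m hm
  obtain ⟨j, hj, h0⟩ := hx b (m + Finsupp.single i 1) (by
    rw [Pi.smul_apply, smul_eq_mul, mul_comm, mem_support_iff, coeff_mul_X]
    exact mem_support_iff.1 hm)
  refine ⟨j, hj, ?_⟩
  have hij : i ≠ j := fun h => hi (h ▸ hj)
  rwa [Finsupp.add_apply, Finsupp.single_eq_of_ne hij.symm, add_zero] at h0

lemma freeComponent_mem_varSubmodule {x : ι → MvPolynomial σ K} (hx : x ∈ varSubmodule K ι A)
    (deg : ι → ℕ) (j : ℕ) : freeComponent deg j x ∈ varSubmodule K ι A := by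
  rw [mem_varSubmodule] at hx ⊢
  refine fun b m hm => hx b m ?_
  rw [mem_support_iff, coeff_freeComponent] at hm
  exact mem_support_iff.2 fun h => hm (by rw [h, ite_self])

lemma freeComponent_X_smul {deg : ι → ℕ} {j : ℕ} {v : ι → MvPolynomial σ K}
    (hv : IsFreeHomogeneous deg j v) (i : σ) :
    freeComponent deg (j + 1) ((X i : MvPolynomial σ K) • v) = (X i : MvPolynomial σ K) • v := by
  have := (hv.monomial_smul (Finsupp.single i 1) 1).freeComponent_self
  rwa [Finsupp.degree_single] at this

lemma X_smul_eq_zero {i : σ} {x : ι → MvPolynomial σ K}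
    (h : (X i : MvPolynomial σ K) • x = 0) : x = 0 :=
  (smul_eq_zero.1 h).resolve_left (X_ne_zero i)

variable {rank : ℕ → ℕ} {deg : ∀ i, Fin (rank i) → ℕ}
  {d : ∀ i, (Fin (rank (i + 1)) → MvPolynomial σ K) →ₗ[MvPolynomial σ K]
    (Fin (rank i) → MvPolynomial σ K)}

/-- If `X e` is regular on the module resolved by an exact complex of free modules, the complex
stays exact in degrees `≥ k + 1` modulo `X e` and `k` further variables. -/
lemma exists_lift_varSubmodule (hex : ∀ i, Function.Exact (d (i + 1)) (d i)) (e : σ)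
    (he : ∀ x, (X e : MvPolynomial σ K) • x ∈ LinearMap.range (d 0) → x ∈ LinearMap.range (d 0))
    (A : Finset σ) (heA : e ∉ A) :
    ∀ j, A.card ≤ j → ∀ x ∈ varSubmodule K (Fin (rank j)) (insert e (A : Set σ)),
      x ∈ LinearMap.range (d j) →
        ∃ a ∈ varSubmodule K (Fin (rank (j + 1))) (insert e (A : Set σ)), d j a = x := by
  classical
  induction A using Finset.induction_on with
  | empty =>
    intro j _ x hx hxr
    obtain ⟨y, a, ha, rfl⟩ := exists_of_mem_varSubmodule_insert hx
    have ha0 : a = 0 := by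
      funext b
      rw [mem_varSubmodule] at ha
      by_contra hne
      obtain ⟨m, hm⟩ := support_nonempty.2 hne
      obtain ⟨i, hi, -⟩ := ha b m hm
      simp at hi
    subst ha0
    rw [add_zero] at hxr ⊢
    -- For j > 0 the cokernel of `d j` embeds in a free module, so `X e` is regular on it; for j = 0
    -- this is the hypothesis `he`.
    have hy : y ∈ LinearMap.range (d j) := by
      cases j with
      | zero => exact he y hxr
      | succ j =>
        have h0 := (hex j _).2 hxr
        rw [map_smul] at h0
        exact (hex j y).1 (X_smul_eq_zero h0)
    obtain ⟨z, rfl⟩ := hy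
    exact ⟨(X e : MvPolynomial σ K) • z, X_smul_mem_varSubmodule (Set.mem_insert _ _) z,
      map_smul _ _ _⟩
  | insert i A hiA ih =>
    have heA' : e ∉ A := fun h => heA (Finset.mem_insert_of_mem h)
    have hei : e ≠ i := fun h => heA (h ▸ Finset.mem_insert_self _ _)
    have hi : i ∉ insert e (A : Set σ) := by
      rintro (h | h)
      · exact hei h.symm
      · exact hiA h
    have hset : insert e ((insert i A : Finset σ) : Set σ) = insert i (insert e (A : Set σ)) := by
      rw [Finset.coe_insert, Set.insert_comm]
    intro j hj x hx hxr
    rw [hset] at hx ⊢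
    rw [Finset.card_insert_of_notMem hiA] at hj
    obtain ⟨f, a, ha, rfl⟩ := exists_of_mem_varSubmodule_insert hx
    obtain _ | j := j
    · omega
    have h0 := (hex j _).2 hxr
    rw [map_add, map_smul] at h0
    -- Modulo the earlier variables `X i` is regular, so `f` is a cycle there; the inductive lift
    -- `a'` corrects it to a genuine boundary.
    have hdf : d j f ∈ varSubmodule K (Fin (rank j)) (insert e (A : Set σ)) := by
      refine mem_varSubmodule_of_X_smul_mem hi ?_
      rw [eq_neg_of_add_eq_zero_left h0]
      exact Submodule.neg_mem _ (map_mem_varSubmodule ha _)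
    obtain ⟨a', ha', hda'⟩ := ih heA' j (by omega) _ hdf ⟨f, rfl⟩
    obtain ⟨g, hg⟩ := (hex j (f - a')).1 (by rw [map_sub, hda', sub_self])
    obtain ⟨a'', ha'', hda''⟩ := ih heA' (j + 1) (by omega)
      (a + (X i : MvPolynomial σ K) • a')
      (Submodule.add_mem _ ha (Submodule.smul_mem _ _ ha')) (by
        have h1 : a + (X i : MvPolynomial σ K) • a' =
            ((X i : MvPolynomial σ K) • f + a) - (X i : MvPolynomial σ K) • d (j + 1) g := by
          rw [hg, smul_sub]; abel
        rw [h1]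
        exact Submodule.sub_mem _ hxr (Submodule.smul_mem _ _ ⟨g, rfl⟩))
    refine ⟨(X i : MvPolynomial σ K) • g + a'', Submodule.add_mem _
      (X_smul_mem_varSubmodule (Set.mem_insert _ _) g)
      (varSubmodule_mono (Set.subset_insert _ _) ha''), ?_⟩
    rw [map_add, map_smul, hg, hda'', smul_sub]
    abel

/-- A socle element modulo `X e` of the module resolved by an exact complex of graded free modules
propagates along the complex, each step killing one more variable. -/
lemma exists_socle_element (hex : ∀ i, Function.Exact (d (i + 1)) (d i))
    (hdeg : ∀ i b, IsFreeHomogeneous (deg i) (deg (i + 1) b) (d i (Pi.single b 1))) (e : σ)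
    (he : ∀ x, (X e : MvPolynomial σ K) • x ∈ LinearMap.range (d 0) → x ∈ LinearMap.range (d 0))
    (n : ℕ) (u : Fin (rank 0) → MvPolynomial σ K) (hu : IsFreeHomogeneous (deg 0) n u)
    (hu₀ : u ∉ LinearMap.range (d 0) ⊔ varSubmodule K _ {e})
    (hu₁ : ∀ l, (X l : MvPolynomial σ K) • u ∈ LinearMap.range (d 0) ⊔ varSubmodule K _ {e})
    (A : Finset σ) (heA : e ∉ A) :
    ∃ w : Fin (rank A.card) → MvPolynomial σ K, IsFreeHomogeneous (deg A.card) (n + A.card) w ∧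
      w ∉ LinearMap.range (d A.card) ⊔ varSubmodule K _ (insert e (A : Set σ)) ∧
      ∀ l, (X l : MvPolynomial σ K) • w ∈
        LinearMap.range (d A.card) ⊔ varSubmodule K _ (insert e (A : Set σ)) := by
  classical
  induction A using Finset.induction_on with
  | empty =>
    refine ⟨u, hu, ?_⟩
    have hset : insert e ((∅ : Finset σ) : Set σ) = {e} := by simp
    rw [hset]
    exact ⟨hu₀, hu₁⟩
  | insert i A hiA ih =>
    have heA' : e ∉ A := fun h => heA (Finset.mem_insert_of_mem h)
    have hei : e ≠ i := fun h => heA (h ▸ Finset.mem_insert_self _ _)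
    have hi : i ∉ insert e (A : Set σ) := by
      rintro (h | h)
      · exact hei h.symm
      · exact hiA h
    have hset : insert e ((insert i A : Finset σ) : Set σ) = insert i (insert e (A : Set σ)) := by
      rw [Finset.coe_insert, Set.insert_comm]
    rw [hset, Finset.card_insert_of_notMem hiA]
    have hlift := exists_lift_varSubmodule hex e he A heA' A.card le_rfl
    obtain ⟨w, hw, hw₀, hw₁⟩ := ih heA'
    generalize A.card = k at *
    obtain ⟨_, ⟨w'', rfl⟩, a₁, ha₁, hwa₁⟩ := Submodule.mem_sup.1 (hw₁ i)
    obtain ⟨w', hw', a, ha, hwa⟩ : ∃ w', IsFreeHomogeneous (deg (k + 1)) (n + (k + 1)) w' ∧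
        ∃ a ∈ varSubmodule K _ (insert e (A : Set σ)),
          d k w' + a = (X i : MvPolynomial σ K) • w := by
      -- The other side of the equation is homogeneous of degree n + k + 1, so passing to that
      -- component loses nothing.
      refine ⟨freeComponent (deg (k + 1)) (n + (k + 1)) w'', isFreeHomogeneous_freeComponent _ _ _,
        freeComponent (deg k) (n + (k + 1)) a₁, freeComponent_mem_varSubmodule ha₁ _ _, ?_⟩
      rw [← freeComponent_map _ (deg k) (d k) (hdeg k), ← freeComponent_add, hwa₁, ← add_assoc,
        freeComponent_X_smul hw]
    refine ⟨w', hw', fun hmem => ?_, fun l => ?_⟩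
    -- If `w'` were trivial, applying `d k` and cancelling `X i` would make `w` trivial too.
    · obtain ⟨_, ⟨g, rfl⟩, q, hq, hgq⟩ := Submodule.mem_sup.1 hmem
      obtain ⟨p, a', ha', rfl⟩ := exists_of_mem_varSubmodule_insert hq
      have hdw : d k w' = (X i : MvPolynomial σ K) • d k p + d k a' := by
        rw [← hgq, map_add, (hex k _).2 ⟨g, rfl⟩, zero_add, map_add, map_smul]
      have hmem' : w - d k p ∈ varSubmodule K _ (insert e (A : Set σ)) := by
        refine mem_varSubmodule_of_X_smul_mem hi ?_
        have h1 : (X i : MvPolynomial σ K) • (w - d k p) = a + d k a' := by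
          rw [smul_sub, ← hwa, hdw]; abel
        rw [h1]
        exact Submodule.add_mem _ ha (map_mem_varSubmodule ha' _)
      refine hw₀ ?_
      rw [← add_sub_cancel (d k p) w]
      exact Submodule.add_mem_sup ⟨p, rfl⟩ hmem'
    · obtain ⟨_, ⟨z, rfl⟩, a', ha', hza'⟩ := Submodule.mem_sup.1 (hw₁ l)
      -- Comparing the two expressions for X_l X_i w shows that `X l • w' - X i • z` is a cycle
      -- modulo the earlier variables.
      have h1 : d k ((X l : MvPolynomial σ K) • w' - (X i : MvPolynomial σ K) • z) =
          (X i : MvPolynomial σ K) • a' - (X l : MvPolynomial σ K) • a := by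
        have h2 : (X l : MvPolynomial σ K) • (d k w' + a) =
            (X i : MvPolynomial σ K) • (d k z + a') := by
          rw [hwa, hza', smul_comm]
        rw [smul_add, smul_add] at h2
        rw [map_sub, map_smul, map_smul, eq_sub_of_add_eq h2]
        abel
      obtain ⟨a'', ha'', hda''⟩ := hlift _ (h1 ▸ Submodule.sub_mem _ (Submodule.smul_mem _ _ ha')
        (Submodule.smul_mem _ _ ha)) ⟨_, rfl⟩
      obtain ⟨g, hg⟩ := (hex k ((X l : MvPolynomial σ K) • w' - (X i : MvPolynomial σ K) • z - a'')).1
        (by rw [map_sub, hda'', sub_self])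
      have h3 : (X l : MvPolynomial σ K) • w' =
          d (k + 1) g + ((X i : MvPolynomial σ K) • z + a'') := by
        rw [hg]; abel
      rw [h3]
      exact Submodule.add_mem_sup ⟨g, rfl⟩ (Submodule.add_mem _
        (X_smul_mem_varSubmodule (Set.mem_insert _ _) z)
        (varSubmodule_mono (Set.subset_insert _ _) ha''))

/-- With all variables in `A`, a vector outside 𝔪F has a coordinate with nonzero constant term, and
homogeneity determines the degree of that basis element. -/
lemma exists_deg_eq_of_notMem_varSubmodule {deg : ι → ℕ} {n : ℕ} {w : ι → MvPolynomial σ K}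
    (hw : IsFreeHomogeneous deg n w) (hA : ∀ i, i ∈ A) (hwA : w ∉ varSubmodule K ι A) :
    ∃ b, deg b = n := by
  rw [mem_varSubmodule] at hwA
  push Not at hwA
  obtain ⟨b, m, hm, h⟩ := hwA
  have hm0 : m = 0 := Finsupp.ext fun i => h i (hA i)
  refine ⟨b, ?_⟩
  have := hw b m hm
  rwa [hm0, map_zero, add_zero] at this

/-- The resolution of an ideal, extended by the polynomial ring itself: the ranks. -/
def augRank (r : ℕ → ℕ) : ℕ → ℕ
  | 0 => 1
  | i + 1 => r i

/-- If `I` is a homogeneous ideal, `X e` is regular modulo `I`, and `I + (X e)` has a socle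
element of degree `n`, then a graded free resolution of `I` has a generator in homological degree
`|σ| - 2` and degree `n + |σ| - 1`. -/
theorem exists_deg_eq_of_socle [Fintype σ] {I : Ideal (MvPolynomial σ K)}
    (F : MinimalGradedFreeResolution (σ := σ) (K := K) (idealGrading I)) (e : σ)
    (he : ∀ f, X e * f ∈ I → f ∈ I) (n : ℕ) (u : MvPolynomial σ K) (hu : u.IsHomogeneous n)
    (hu₀ : u ∉ I ⊔ Ideal.span {X e}) (hu₁ : ∀ l, X l * u ∈ I ⊔ Ideal.span {X e})
    (k : ℕ) (hk : Fintype.card σ = k + 2) :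
    ∃ b, F.deg k b = n + (k + 1) := by
  classical
  let deg : ∀ i, Fin (augRank F.rank i) → ℕ := fun i => match i with
    | 0 => fun _ => 0
    | i + 1 => F.deg i
  let d₀ : (Fin (F.rank 0) → MvPolynomial σ K) →ₗ[MvPolynomial σ K] (Fin 1 → MvPolynomial σ K) :=
    LinearMap.pi fun _ => (Submodule.subtype I).comp F.ε
  let d : ∀ i, (Fin (augRank F.rank (i + 1)) → MvPolynomial σ K) →ₗ[MvPolynomial σ K]
      (Fin (augRank F.rank i) → MvPolynomial σ K) := fun i => match i with
    | 0 => d₀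
    | i + 1 => F.d i
  have hd₀ : ∀ v, d₀ v = 0 ↔ F.ε v = 0 := by
    intro v
    refine ⟨fun h => Subtype.ext (congrFun h 0), fun h => ?_⟩
    funext b
    change ((F.ε v : I) : MvPolynomial σ K) = 0
    rw [h]; rfl
  have hrange : ∀ x, x ∈ LinearMap.range d₀ ↔ x 0 ∈ I := by
    intro x
    constructor
    · rintro ⟨v, rfl⟩
      exact (F.ε v).2
    · intro hx
      obtain ⟨v, hv⟩ := F.ε_surjective ⟨x 0, hx⟩
      refine ⟨v, funext fun b => ?_⟩
      rw [Subsingleton.elim b 0]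
      exact congrArg Subtype.val hv
  have hex : ∀ i, Function.Exact (d (i + 1)) (d i) := by
    intro i
    cases i with
    | zero => exact fun y => (hd₀ y).trans (F.exact_zero y)
    | succ i => exact F.exact_succ i
  have hdeg : ∀ i b, IsFreeHomogeneous (deg i) (deg (i + 1) b) (d i (Pi.single b 1)) := by
    intro i
    cases i with
    | zero =>
      intro b _ m hm
      have := F.ε_deg b (mem_support_iff.1 hm)
      exact (zero_add _).trans ((DFunLike.congr_fun Finsupp.degree_eq_weight_one m).trans this)
    | succ i => exact F.d_deg i
  have hsup : ∀ x : Fin 1 → MvPolynomial σ K,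
      x ∈ LinearMap.range d₀ ⊔ varSubmodule K _ {e} ↔ x 0 ∈ I ⊔ Ideal.span {X e} := by
    intro x
    constructor
    · intro hx
      obtain ⟨y, hy, z, hz, rfl⟩ := Submodule.mem_sup.1 hx
      refine Submodule.add_mem_sup ((hrange y).1 hy) ?_
      simpa [varSubmodule] using hz
    · intro hx
      obtain ⟨y, hy, z, hz, hyz⟩ := Submodule.mem_sup.1 hx
      have hx' : x = (fun _ => y) + (fun _ => z) := by
        funext b
        rw [Subsingleton.elim b 0]
        exact hyz.symm
      rw [hx']
      refine Submodule.add_mem_sup ((hrange _).2 hy) ?_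
      simpa [varSubmodule] using hz
  -- All variables but `e` are used, that is k + 1 of them; position k + 1 of the augmented complex
  -- is position k of `F`.
  obtain ⟨w, hw, hw₀, -⟩ := exists_socle_element (rank := augRank F.rank) (deg := deg) (d := d)
    hex hdeg e (fun x hx => (hrange x).2 (he _ ((hrange _).1 hx))) n (fun _ => u)
    (fun _ m hm => by
      have := hu (mem_support_iff.1 hm)
      exact (zero_add _).trans ((DFunLike.congr_fun Finsupp.degree_eq_weight_one m).trans this))
    (fun h => hu₀ ((hsup _).1 h)) (fun l => (hsup _).2 (hu₁ l))
    (Finset.univ.erase e) (Finset.notMem_erase e _)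
  have hcard : (Finset.univ.erase e).card = k + 1 := by
    rw [Finset.card_erase_of_mem (Finset.mem_univ e), Finset.card_univ, hk]; rfl
  have hb := exists_deg_eq_of_notMem_varSubmodule hw
    (A := insert e ((Finset.univ.erase e : Finset σ) : Set σ)) (fun i => by
      by_cases h : i = e
      · exact Or.inl h
      · exact Or.inr (by simp [h]))
    (fun h => hw₀ (Submodule.mem_sup_right h))
  rw [hcard] at hb
  exact hb

end Socle

/-! ### Joins and even edge sets -/

section Joins

variable {V : Type*} {G : SimpleGraph V}

open Classical in
/-- Every vertex lies on an even number of edges of `C`. -/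
def IsEvenSet (C : Finset (Sym2 V)) : Prop :=
  ∀ v : V, Even (C.filter fun f => v ∈ f).card

open SimpleGraph in
/-- A nonempty even set of edges contains the edges of a cycle. -/
lemma IsEvenSet.not_isAcyclic {C : Finset (Sym2 V)} (hC : IsEvenSet C)
    (hG : (C : Set (Sym2 V)) ⊆ G.edgeSet) (hne : C.Nonempty) :
    ¬ (fromEdgeSet (C : Set (Sym2 V))).IsAcyclic := by
  classical
  intro hac
  obtain ⟨f, hf⟩ := hne
  induction f using Sym2.ind with
  | _ x y =>
  have hxy : (fromEdgeSet (C : Set (Sym2 V))).Adj x y :=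
    (fromEdgeSet_adj _).2 ⟨hf, ((mem_edgeSet G).1 (hG hf)).ne⟩
  have : Nonempty V := ⟨x⟩
  have : Finite (fromEdgeSet (C : Set (Sym2 V))).edgeSet := by
    rw [edgeSet_fromEdgeSet]
    exact (C.finite_toSet.subset Set.sdiff_subset).to_subtype
  obtain ⟨u, v, p, hp, hmax⟩ :=
    Walk.exists_isPath_forall_isPath_length_le_length (fromEdgeSet (C : Set (Sym2 V)))
  have hnil : ¬ p.Nil := by
    intro h
    have h1 := hmax _ _ _ (Path.singleton hxy).2
    have h2 := Walk.length_eq_zero_iff.2 h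
    rw [h2] at h1
    simp at h1
  -- The end of a longest path is a leaf: another neighbour would extend the path, a cycle being
  -- excluded. A leaf has odd degree 1.
  have huniq : ∀ w, (fromEdgeSet (C : Set (Sym2 V))).Adj v w → w = p.penultimate := by
    intro w hadj
    apply hac.eq_penultimate_of_adj_end hp hadj
    by_contra hw
    have h1 := hmax _ _ _ (hp.concat hw hadj)
    rw [Walk.length_concat] at h1
    omega
  have hpen := (fromEdgeSet_adj _).1 (p.adj_penultimate hnil)
  have hfilter : (C.filter fun f => v ∈ f) = {s(p.penultimate, v)} := by
    ext f
    rw [Finset.mem_filter, Finset.mem_singleton]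
    constructor
    · rintro ⟨hfC, hvf⟩
      obtain ⟨w, rfl⟩ := hvf
      have hadj : (fromEdgeSet (C : Set (Sym2 V))).Adj v w :=
        (fromEdgeSet_adj _).2 ⟨hfC, ((mem_edgeSet G).1 (hG hfC)).ne⟩
      rw [huniq w hadj, Sym2.eq_swap]
    · rintro rfl
      exact ⟨hpen.1, Sym2.mem_mk_right _ _⟩
  have := hC v
  rw [hfilter, Finset.card_singleton] at this
  exact absurd this (by decide)

open Classical in
/-- A join contains at most half of the edges of every even edge set. -/
lemma IsJoin.two_mul_card_inter_le {J : Finset (Sym2 V)} (hJ : IsJoin G J) (C : Finset (Sym2 V))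
    (hG : (C : Set (Sym2 V)) ⊆ G.edgeSet) (hC : IsEvenSet C) : 2 * (J ∩ C).card ≤ C.card := by
  induction C using Finset.strongInduction with
  | H C ih =>
  rcases C.eq_empty_or_nonempty with rfl | hne
  · simp
  have hle : SimpleGraph.fromEdgeSet (C : Set (Sym2 V)) ≤ G := by
    intro a b hab
    exact (SimpleGraph.mem_edgeSet G).1 (hG ((SimpleGraph.fromEdgeSet_adj _).1 hab).1)
  obtain ⟨v, c, hc⟩ : ∃ (v : V) (c : (SimpleGraph.fromEdgeSet (C : Set (Sym2 V))).Walk v v),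
      c.IsCycle := by
    by_contra h
    push Not at h
    exact hC.not_isAcyclic hG hne h
  set T := c.edges.toFinset with hT
  have hTC : T ⊆ C := by
    intro f hf
    have hf' := c.edges_subset_edgeSet (List.mem_toFinset.1 hf)
    rw [SimpleGraph.edgeSet_fromEdgeSet] at hf'
    exact hf'.1
  have hTcard : T.card = c.length := by
    rw [hT, List.toFinset_card_of_nodup hc.edges_nodup, SimpleGraph.Walk.length_edges]
  have hTne : T.Nonempty := by
    rw [← Finset.card_pos, hTcard]
    exact lt_of_lt_of_le (by norm_num) hc.three_le_length
  have hTeven : IsEvenSet T := by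
    intro x
    have h1 : (T.filter fun f => x ∈ f).card = c.edges.countP fun f => x ∈ f := by
      have h0 : (T.filter fun f => x ∈ f) = (c.edges.filter fun f => x ∈ f).toFinset := by
        ext f; simp [hT]
      rw [h0, List.toFinset_card_of_nodup (hc.edges_nodup.filter _),
        List.countP_eq_length_filter]
    rw [h1, hc.isTrail.even_countP_edges_iff]
    exact fun h => absurd rfl h
  have hJT : 2 * (J ∩ T).card ≤ T.card := by
    have h1 := hJ.2 v (c.mapLe hle) (hc.mapLe hle)
    rw [SimpleGraph.Walk.edges_mapLe_eq_edges, SimpleGraph.Walk.length_map, ← hTcard] at h1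
    exact h1
  -- A cycle is itself even, so removing it leaves a smaller even set, and the two inequalities add
  -- up.
  have hrec := ih (C \ T) (Finset.sdiff_ssubset hTC hTne)
    (fun f hf => hG (Finset.mem_sdiff.1 hf).1) (by
      intro x
      have h1 : ((C \ T).filter fun f => x ∈ f) =
          (C.filter fun f => x ∈ f) \ (T.filter fun f => x ∈ f) := by
        ext f; simp only [Finset.mem_filter, Finset.mem_sdiff]; tauto
      have h2 := Finset.filter_subset_filter (fun f => x ∈ f) hTC
      rw [h1, Finset.card_sdiff_of_subset h2, Nat.even_sub (Finset.card_le_card h2)]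
      exact iff_of_true (hC x) (hTeven x))
  have h1 : (J ∩ C).card = (J ∩ T).card + (J ∩ (C \ T)).card := by
    rw [← Finset.card_union_of_disjoint (Finset.disjoint_left.2 fun f hf hf' =>
      (Finset.mem_sdiff.1 (Finset.mem_inter.1 hf').2).2 (Finset.mem_inter.1 hf).2),
      ← Finset.inter_union_distrib_left, Finset.union_sdiff_of_subset hTC]
  have h2 := Finset.card_sdiff_add_card_eq_card hTC
  omega

open Classical in
/-- If `J` is a join, `e ∈ J`, and `B` is a set of edges with the same degree parities as `J \ e`,
then `B` has more edges than `J \ e` if it contains `e`, and at least as many otherwise. -/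
lemma IsJoin.card_erase_le {J B : Finset (Sym2 V)} (hJ : IsJoin G J) {e : Sym2 V} (he : e ∈ J)
    (hB : (B : Set (Sym2 V)) ⊆ G.edgeSet) (hsymm : IsEvenSet (symmDiff B (J.erase e))) :
    (J.erase e).card + (if e ∈ B then 2 else 0) ≤ B.card := by
  have h := hJ.two_mul_card_inter_le _ (by
    intro f hf
    rcases Finset.mem_symmDiff.1 hf with h | h
    · exact hB h.1
    · exact hJ.1 (Finset.mem_of_mem_erase h.1)) hsymm
  have h1 : (symmDiff B (J.erase e)).card = (B \ J.erase e).card + (J.erase e \ B).card := by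
    rw [symmDiff_def, Finset.sup_eq_union, Finset.card_union_of_disjoint disjoint_sdiff_sdiff]
  -- When `e ∈ B`, the edge `e` is an additional element of J in the symmetric difference; doubling
  -- in the join inequality turns this 1 into the 2 of the claim.
  have h2 : (J.erase e \ B).card + (if e ∈ B then 1 else 0) ≤
      (J ∩ symmDiff B (J.erase e)).card := by
    have hsub : J.erase e \ B ⊆ J ∩ symmDiff B (J.erase e) := by
      intro f hf
      have hf' := Finset.mem_sdiff.1 hf
      exact Finset.mem_inter.2 ⟨Finset.mem_of_mem_erase hf'.1, Finset.mem_symmDiff.2 (Or.inr hf')⟩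
    split_ifs with heB
    · have hne : e ∉ J.erase e \ B := fun h => (Finset.mem_sdiff.1 h).2 heB
      rw [← Finset.card_insert_of_notMem hne]
      refine Finset.card_le_card (Finset.insert_subset ?_ hsub)
      exact Finset.mem_inter.2 ⟨he, Finset.mem_symmDiff.2 (Or.inl ⟨heB, Finset.notMem_erase _ _⟩)⟩
    · simpa using Finset.card_le_card hsub
  have h3 := Finset.card_sdiff_add_card_inter B (J.erase e)
  have h4 := Finset.card_sdiff_add_card_inter (J.erase e) B
  rw [Finset.inter_comm] at h4
  split_ifs at h2 ⊢ <;> omega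

end Joins

/-! ### Monomial maps to group algebras -/

section Toric

variable {σ Γ : Type*} (K : Type*) [Field K] [AddCommGroup Γ]

/-- The algebra map from the polynomial ring to the group algebra of `Γ` sending the variable `i`
to the group element `g i`. -/
def toricMap (g : σ → Γ) : MvPolynomial σ K →ₐ[K] AddMonoidAlgebra K Γ :=
  aeval fun i => AddMonoidAlgebra.single (g i) 1

variable {K}

lemma toricMap_X (g : σ → Γ) (i : σ) :
    toricMap K g (X i) = AddMonoidAlgebra.single (g i) 1 :=
  aeval_X _ _

lemma toricMap_monomial (g : σ → Γ) (a : σ →₀ ℕ) (r : K) :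
    toricMap K g (monomial a r) =
      AddMonoidAlgebra.single (Finsupp.linearCombination ℕ g a) r := by
  induction a using Finsupp.induction with
  | zero =>
    rw [map_zero, ← C_apply, ← algebraMap_eq, AlgHom.commutes]
    rfl
  | single_add i k a _ _ ih =>
    have h : monomial (Finsupp.single i k + a) r = X i ^ k * monomial a r := by
      rw [X_pow_eq_monomial, monomial_mul, one_mul]
    rw [h, map_mul, map_pow, ih, toricMap_X, AddMonoidAlgebra.single_pow,
      AddMonoidAlgebra.single_mul_single, one_pow, one_mul, map_add,
      Finsupp.linearCombination_single]

lemma exists_mem_support_of_coeff_toricMap_ne_zero (g : σ → Γ) (f : MvPolynomial σ K) (γ : Γ)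
    (h : (toricMap K g f).coeff γ ≠ 0) :
    ∃ a ∈ f.support, Finsupp.linearCombination ℕ g a = γ := by
  classical
  by_contra hcon
  push Not at hcon
  apply h
  rw [f.as_sum, map_sum, AddMonoidAlgebra.coeff_sum, Finsupp.finsetSum_apply]
  refine Finset.sum_eq_zero fun a ha => ?_
  rw [toricMap_monomial, AddMonoidAlgebra.coeff_single, Finsupp.single_apply, if_neg (hcon a ha)]

/-- The image of a variable is a unit, with inverse the group element `-g i`. -/
lemma toricMap_X_mul_eq_zero {g : σ → Γ} {i : σ} {f : MvPolynomial σ K}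
    (h : toricMap K g (X i * f) = 0) : toricMap K g f = 0 := by
  have h1 : AddMonoidAlgebra.single (-g i) (1 : K) * toricMap K g (X i * f) = toricMap K g f := by
    rw [map_mul, toricMap_X, ← mul_assoc, AddMonoidAlgebra.single_mul_single, neg_add_cancel,
      one_mul, ← AddMonoidAlgebra.one_def, one_mul]
  rw [← h1, h, mul_zero]

end Toric

/-! ### The ideal of a graph as a toric ideal -/

section GraphIdeal

variable {V : Type*} (K : Type*) [Field K] {G : SimpleGraph V}

/-- The group element of a vertex: degree one and the indicator vector modulo two. -/
def vertexClass [DecidableEq V] (i : V) : ℤ × (V → ZMod 2) := (1, Pi.single i 1)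

/-- The group element of an edge. -/
def edgeClass [DecidableEq V] (e : G.edgeSet) : ℤ × (V → ZMod 2) :=
  Sym2.lift ⟨fun i j => vertexClass i + vertexClass j, fun _ _ => add_comm _ _⟩ (e : Sym2 V)

/-- The ideal generated by the differences of squares of variables. -/
abbrev squareIdeal (V : Type*) : Ideal (MvPolynomial V K) :=
  Ideal.span {p | ∃ i j : V, p = X i ^ 2 - X j ^ 2}

variable {K}

lemma linearCombination_vertexClass [DecidableEq V] (a : V →₀ ℕ) :
    Finsupp.linearCombination ℕ vertexClass a = ((a.degree : ℤ), fun i => (a i : ZMod 2)) := by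
  induction a using Finsupp.induction_linear with
  | zero => simp; rfl
  | add a b ha hb =>
    rw [map_add, ha, hb]
    ext i <;> simp
  | single i k =>
    rw [Finsupp.linearCombination_single]
    ext j
    · simp [vertexClass]
    · by_cases h : j = i
      · subst h; simp [vertexClass]
      · simp [vertexClass, h]

/-- All squares agree in the quotient, so every square factor can be moved to `i₀`. The resulting
normal form depends only on the degree and the parities of the exponents. -/
lemma mk_monomial_eq (i₀ : V) (a : V →₀ ℕ) :
    Ideal.Quotient.mk (squareIdeal K V) (monomial a 1) =
      Ideal.Quotient.mk (squareIdeal K V)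
        ((X i₀ ^ 2) ^ (a.sum fun _ k => k / 2) * a.prod fun i k => X i ^ (k % 2)) := by
  have hX : ∀ i, Ideal.Quotient.mk (squareIdeal K V) (X i ^ 2) =
      Ideal.Quotient.mk (squareIdeal K V) (X i₀ ^ 2) := fun i =>
    Ideal.Quotient.eq.2 (Ideal.subset_span ⟨i, i₀, rfl⟩)
  rw [monomial_eq, C_1, one_mul, Finsupp.sum, Finsupp.prod, Finsupp.prod,
    ← Finset.prod_pow_eq_pow_sum, ← Finset.prod_mul_distrib, map_prod, map_prod]
  refine Finset.prod_congr rfl fun i _ => ?_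
  conv_lhs => rw [← Nat.div_add_mod (a i) 2, pow_add, pow_mul, map_mul, map_pow, hX]
  simp only [map_mul, map_pow]

lemma mk_monomial_eq_of_class_eq [DecidableEq V] [Finite V] {a b : V →₀ ℕ}
    (h : Finsupp.linearCombination ℕ vertexClass a = Finsupp.linearCombination ℕ vertexClass b) :
    Ideal.Quotient.mk (squareIdeal K V) (monomial a 1) =
      Ideal.Quotient.mk (squareIdeal K V) (monomial b 1) := by
  cases nonempty_fintype V
  rcases isEmpty_or_nonempty V with hV | ⟨⟨i₀⟩⟩
  · rw [Subsingleton.elim a b]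
  rw [linearCombination_vertexClass, linearCombination_vertexClass, Prod.mk.injEq] at h
  have hmod : ∀ i, a i % 2 = b i % 2 := fun i =>
    (ZMod.natCast_eq_natCast_iff' _ _ _).1 (congrFun h.2 i)
  have hdeg : a.degree = b.degree := by exact_mod_cast h.1
  have hsum : ∀ c : V →₀ ℕ, c.degree = 2 * (∑ i, c i / 2) + ∑ i, c i % 2 := by
    intro c
    rw [Finsupp.degree_eq_sum, Finset.mul_sum, ← Finset.sum_add_distrib]
    exact Finset.sum_congr rfl fun i _ => (Nat.div_add_mod (c i) 2).symm
  have hdiv : ∑ i, a i / 2 = ∑ i, b i / 2 := by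
    have h1 := hsum a
    have h2 := hsum b
    rw [Finset.sum_congr rfl fun i _ => hmod i] at h1
    omega
  rw [mk_monomial_eq i₀ a, mk_monomial_eq i₀ b, Finsupp.sum_fintype _ _ (by simp),
    Finsupp.sum_fintype _ _ (by simp), Finsupp.prod_fintype _ _ (by simp),
    Finsupp.prod_fintype _ _ (by simp), hdiv, Finset.prod_congr rfl fun i _ => by rw [hmod i]]

lemma mem_squareIdeal_iff [DecidableEq V] [Finite V] (f : MvPolynomial V K) :
    f ∈ squareIdeal K V ↔ toricMap K vertexClass f = 0 := by
  constructor
  · intro hf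
    have hle : squareIdeal K V ≤ RingHom.ker (toricMap K (vertexClass (V := V))) := by
      rw [Ideal.span_le]
      rintro _ ⟨i, j, rfl⟩
      have h2 : ∀ i : V, (2 : ℕ) • (Pi.single i 1 : V → ZMod 2) = 0 := by
        intro i
        rw [two_nsmul, ← Pi.single_add]
        have : (1 + 1 : ZMod 2) = 0 := by decide
        rw [this, Pi.single_zero]
      rw [SetLike.mem_coe, RingHom.mem_ker, map_sub, map_pow, map_pow, toricMap_X, toricMap_X,
        AddMonoidAlgebra.single_pow, AddMonoidAlgebra.single_pow, vertexClass, vertexClass,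
        Prod.smul_mk, Prod.smul_mk, h2, h2, sub_self]
    exact hle hf
  · intro hf
    let cls : (V →₀ ℕ) → ℤ × (V → ZMod 2) := Finsupp.linearCombination ℕ vertexClass
    let s : ℤ × (V → ZMod 2) → (V →₀ ℕ) := Function.invFun cls
    have hs : ∀ a, cls (s (cls a)) = cls a := fun a => Function.invFun_eq ⟨a, rfl⟩
    -- Choosing a representative monomial in each class gives a linear map through which the
    -- quotient map factors, so the kernel of the toric map lies in the ideal.
    let ρ : ((ℤ × (V → ZMod 2)) →₀ K) →ₗ[K] (MvPolynomial V K ⧸ squareIdeal K V) :=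
      Finsupp.linearCombination K fun γ => Ideal.Quotient.mk _ (monomial (s γ) 1)
    have hρ : ∀ f, ρ (toricMap K vertexClass f).coeff = Ideal.Quotient.mk _ f := by
      intro f
      induction f using MvPolynomial.induction_on' with
      | monomial a r =>
        rw [toricMap_monomial, AddMonoidAlgebra.coeff_single, Finsupp.linearCombination_single,
          mk_monomial_eq_of_class_eq (hs a)]
        have : (monomial a r : MvPolynomial V K) = r • monomial a 1 := by
          rw [smul_monomial, smul_eq_mul, mul_one]
        rw [this]
        rfl
      | add p q hp hq => rw [map_add, AddMonoidAlgebra.coeff_add, map_add, hp, hq, map_add]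
    rw [← Ideal.Quotient.eq_zero_iff_mem, ← hρ, hf, AddMonoidAlgebra.coeff_zero, map_zero]

lemma toricMap_theta [DecidableEq V] (f : MvPolynomial G.edgeSet K) :
    toricMap K vertexClass (theta K G f) = toricMap K edgeClass f := by
  rw [← AlgHom.comp_apply]
  congr 1
  refine MvPolynomial.algHom_ext fun e => ?_
  rw [AlgHom.comp_apply, theta, aeval_X, toricMap_X]
  obtain ⟨e, he⟩ := e
  induction e using Sym2.ind with
  | _ i j =>
  simp only [edgeClass, Sym2.lift_mk, map_mul, toricMap_X, AddMonoidAlgebra.single_mul_single,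
    one_mul]

lemma mem_graphIdeal_iff [DecidableEq V] [Finite V] (f : MvPolynomial G.edgeSet K) :
    f ∈ graphIdeal K G ↔ toricMap K edgeClass f = 0 := by
  rw [← toricMap_theta, ← mem_squareIdeal_iff]
  exact Ideal.mem_comap

lemma edgeClass_fst [DecidableEq V] (e : G.edgeSet) : (edgeClass e).1 = 2 := by
  obtain ⟨e, he⟩ := e
  induction e using Sym2.ind with
  | _ i j => rfl

lemma edgeClass_snd [DecidableEq V] (e : G.edgeSet) (v : V) [Decidable (v ∈ (e : Sym2 V))] :
    (edgeClass e).2 v = if v ∈ (e : Sym2 V) then 1 else 0 := by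
  obtain ⟨e, he⟩ := e
  induction e using Sym2.ind with
  | _ i j =>
  have hij : i ≠ j := ((SimpleGraph.mem_edgeSet G).1 he).ne
  simp only [edgeClass, Sym2.lift_mk, vertexClass, Prod.snd_add, Pi.add_apply, Sym2.mem_iff,
    Pi.single_apply]
  by_cases h1 : v = i
  · simp [h1, hij]
  · by_cases h2 : v = j
    · simp [h2, hij.symm]
    · simp [h1, h2]

lemma linearCombination_edgeClass_fst [DecidableEq V] (a : G.edgeSet →₀ ℕ) :
    (Finsupp.linearCombination ℕ edgeClass a).1 = 2 * (a.degree : ℤ) := by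
  induction a using Finsupp.induction_linear with
  | zero => simp
  | add a b ha hb => rw [map_add, Prod.fst_add, ha, hb, map_add, Nat.cast_add, mul_add]
  | single e k =>
    rw [Finsupp.linearCombination_single, Prod.smul_fst, edgeClass_fst, Finsupp.degree_single]
    simp [mul_comm]

/-- The first coordinate of a class is twice the degree, so taking the component of degree `j`
restricts the image to the classes with first coordinate 2j. -/
lemma homogeneousComponent_mem_graphIdeal [Finite V] {f : MvPolynomial G.edgeSet K}
    (hf : f ∈ graphIdeal K G) (j : ℕ) : homogeneousComponent j f ∈ graphIdeal K G := by
  classical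
  have key : ∀ (f : MvPolynomial G.edgeSet K) γ,
      (toricMap K edgeClass (homogeneousComponent j f)).coeff γ =
        if γ.1 = 2 * (j : ℤ) then (toricMap K edgeClass f).coeff γ else 0 := by
    intro f γ
    induction f using MvPolynomial.induction_on' with
    | monomial a r =>
      rw [homogeneousComponent_of_mem (isHomogeneous_monomial r rfl)]
      by_cases hj : j = a.degree
      · rw [if_pos hj, toricMap_monomial, AddMonoidAlgebra.coeff_single, Finsupp.single_apply]
        split_ifs with h1 h2
        · rfl
        · exact absurd (by rw [← h1, linearCombination_edgeClass_fst, hj]) h2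
        · rfl
        · rfl
      · rw [if_neg hj, map_zero, toricMap_monomial, AddMonoidAlgebra.coeff_single,
          Finsupp.single_apply]
        split_ifs with h1 h2
        · rw [← h2, linearCombination_edgeClass_fst] at h1
          omega
        · rfl
        · rfl
    | add p q hp hq =>
      rw [map_add, map_add, map_add, AddMonoidAlgebra.coeff_add, AddMonoidAlgebra.coeff_add,
        Finsupp.add_apply, Finsupp.add_apply, hp, hq]
      split_ifs <;> simp
  rw [mem_graphIdeal_iff] at hf ⊢
  ext γ
  rw [key, hf]
  simp

lemma mem_graphIdeal_of_X_mul_mem [Finite V] (e : G.edgeSet) {f : MvPolynomial G.edgeSet K}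
    (h : X e * f ∈ graphIdeal K G) : f ∈ graphIdeal K G := by
  classical
  rw [mem_graphIdeal_iff] at h ⊢
  exact toricMap_X_mul_eq_zero h

/-- Doubling kills the (ℤ/2)^V part, so every t_e² has class (4, 0). -/
lemma X_sq_sub_X_sq_mem_graphIdeal [Finite V] (e f : G.edgeSet) :
    X e ^ 2 - X f ^ 2 ∈ graphIdeal K G := by
  classical
  have h2 : ∀ e : G.edgeSet, (2 : ℕ) • edgeClass e = ((4 : ℤ), (0 : V → ZMod 2)) := by
    intro e
    rw [two_nsmul]
    ext v
    · rw [Prod.fst_add, edgeClass_fst]; rfl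
    · rw [Prod.snd_add, Pi.add_apply]
      exact CharTwo.add_self_eq_zero _
  rw [mem_graphIdeal_iff, map_sub, map_pow, map_pow, toricMap_X, toricMap_X,
    AddMonoidAlgebra.single_pow, AddMonoidAlgebra.single_pow, h2, h2, sub_self]

lemma one_notMem_graphIdeal [Finite V] : (1 : MvPolynomial G.edgeSet K) ∉ graphIdeal K G := by
  classical
  rw [mem_graphIdeal_iff, map_one]
  exact one_ne_zero

end GraphIdeal

/-! ### Socle elements of the graph ideal modulo an edge variable -/

section GraphSocle

variable {V : Type*} {K : Type*} [Field K] {G : SimpleGraph V}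

/-- A monomial outside an ideal containing the squares of the variables has a multiple that is a
socle element. -/
lemma exists_monomial_socle {σ : Type*} [Fintype σ] {Q : Ideal (MvPolynomial σ K)}
    (hsq : ∀ l, X l ^ 2 ∈ Q) (m : σ →₀ ℕ) (hm : monomial m 1 ∉ Q) :
    ∃ m' : σ →₀ ℕ, m.degree ≤ m'.degree ∧ monomial m' 1 ∉ Q ∧ ∀ l, X l * monomial m' 1 ∈ Q := by
  have hbound : ∀ m : σ →₀ ℕ, monomial m 1 ∉ Q → m.degree ≤ Fintype.card σ := by
    intro m hm
    rw [Finsupp.degree_eq_sum, ← Finset.card_univ, Finset.card_eq_sum_ones]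
    refine Finset.sum_le_sum fun l _ => ?_
    by_contra hl
    apply hm
    have h1 : Finsupp.single l 2 ≤ m := by
      rw [Finsupp.single_le_iff]; omega
    rw [← tsub_add_cancel_of_le h1, ← one_mul (1 : K), ← monomial_mul, ← X_pow_eq_monomial]
    exact Ideal.mul_mem_left _ _ (hsq l)
  by_contra hcon
  push Not at hcon
  -- Without a socle monomial one could multiply by variables forever, but outside `Q` monomials are
  -- squarefree and so have bounded degree.
  have key : ∀ k, ∃ m' : σ →₀ ℕ, m.degree + k ≤ m'.degree ∧ monomial m' 1 ∉ Q := by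
    intro k
    induction k with
    | zero => exact ⟨m, le_rfl, hm⟩
    | succ k ih =>
      obtain ⟨m', h1, h2⟩ := ih
      obtain ⟨l, hl⟩ := hcon m' (by omega) h2
      refine ⟨Finsupp.single l 1 + m', ?_, ?_⟩
      · rw [map_add, Finsupp.degree_single]; omega
      · rwa [← one_mul (1 : K), ← monomial_mul]
  obtain ⟨m', h1, h2⟩ := key (Fintype.card σ + 1)
  have := hbound m' h2
  omega

open Classical in
/-- The exponent vector of the squarefree monomial of a set of edges. -/
def edgeMonomial (G : SimpleGraph V) [Finite G.edgeSet] (J : Finset (Sym2 V)) : G.edgeSet →₀ ℕ :=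
  Finsupp.equivFunOnFinite.symm fun f => if (f : Sym2 V) ∈ J then 1 else 0

open Classical in
lemma degree_edgeMonomial [Fintype G.edgeSet] {J : Finset (Sym2 V)}
    (hJ : (J : Set (Sym2 V)) ⊆ G.edgeSet) : (edgeMonomial G J).degree = J.card := by
  rw [Finsupp.degree_eq_sum]
  change ∑ f : G.edgeSet, (if (f : Sym2 V) ∈ J then 1 else 0) = _
  rw [← Finset.card_filter]
  refine Finset.card_bij (fun f _ => (f : Sym2 V)) (fun f hf => (Finset.mem_filter.1 hf).2)
    (fun f _ g _ h => Subtype.ext h) fun f hf => ⟨⟨f, hJ hf⟩, by simpa using hf, rfl⟩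

open Classical in
/-- The set of edges with odd exponent. -/
def oddEdges [Fintype G.edgeSet] (b : G.edgeSet →₀ ℕ) : Finset (Sym2 V) :=
  (Finset.univ.filter fun f : G.edgeSet => Odd (b f)).map ⟨Subtype.val, Subtype.val_injective⟩

lemma oddEdges_subset [Fintype G.edgeSet] (b : G.edgeSet →₀ ℕ) :
    (oddEdges b : Set (Sym2 V)) ⊆ G.edgeSet := by
  intro f hf
  obtain ⟨g, -, rfl⟩ := Finset.mem_map.1 hf
  exact g.2

lemma mem_oddEdges [Fintype G.edgeSet] (b : G.edgeSet →₀ ℕ) (f : G.edgeSet) :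
    (f : Sym2 V) ∈ oddEdges b ↔ Odd (b f) := by
  simp [oddEdges]

-- Each odd exponent contributes at least 1 to the degree; if the nonzero exponent at `e` is even,
-- it contributes at least 2 without being counted.
open Classical in
lemma card_oddEdges_add_le [Fintype G.edgeSet] (b : G.edgeSet →₀ ℕ) (e : G.edgeSet)
    (he : b e ≠ 0) : (oddEdges b).card + (if (e : Sym2 V) ∈ oddEdges b then 0 else 2) ≤ b.degree := by
  rw [Finsupp.degree_eq_sum, oddEdges, Finset.card_map, Finset.card_filter, ← oddEdges]
  have h1 : (if (e : Sym2 V) ∈ oddEdges b then 0 else 2) =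
      ∑ f : G.edgeSet, if f = e then (if Odd (b e) then 0 else 2) else 0 := by
    rw [Finset.sum_ite_eq' Finset.univ e, if_pos (Finset.mem_univ e)]
    exact if_congr (mem_oddEdges b e) rfl rfl
  rw [h1, ← Finset.sum_add_distrib]
  refine Finset.sum_le_sum fun f _ => ?_
  by_cases hf : f = e
  · subst hf
    by_cases ho : Odd (b f)
    · simp only [if_pos, ho]; omega
    · have := Nat.not_odd_iff_even.1 ho
      obtain ⟨r, hr⟩ := this
      simp only [if_neg ho, if_pos]; omega
  · rw [if_neg hf]
    split_ifs with ho
    · obtain ⟨r, hr⟩ := ho; omega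
    · omega

-- The second coordinate of a class records vertex degrees modulo 2, so equal classes cancel at
-- every vertex.
open Classical in
lemma isEvenSet_symmDiff [Fintype G.edgeSet] {b : G.edgeSet →₀ ℕ} {J : Finset (Sym2 V)}
    (hJ : (J : Set (Sym2 V)) ⊆ G.edgeSet)
    (h : Finsupp.linearCombination ℕ edgeClass b =
      Finsupp.linearCombination ℕ edgeClass (edgeMonomial G J)) :
    IsEvenSet (symmDiff (oddEdges b) J) := by
  intro v
  have hcls : ∀ a : G.edgeSet →₀ ℕ, (Finsupp.linearCombination ℕ edgeClass a).2 v =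
      ∑ f : G.edgeSet, (a f : ZMod 2) * if v ∈ (f : Sym2 V) then 1 else 0 := by
    intro a
    rw [Finsupp.linearCombination_apply, Finsupp.sum_fintype _ _ (by simp), Prod.snd_sum,
      Finset.sum_apply]
    refine Finset.sum_congr rfl fun f _ => ?_
    rw [Prod.smul_snd, Pi.smul_apply, edgeClass_snd, nsmul_eq_mul]
  have hsub : ∀ f ∈ symmDiff (oddEdges b) J, f ∈ G.edgeSet := by
    intro f hf
    rcases Finset.mem_symmDiff.1 hf with hf | hf
    · exact oddEdges_subset b hf.1
    · exact hJ hf.1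
  have hcard : ((symmDiff (oddEdges b) J).filter fun f => v ∈ f).card =
      (Finset.univ.filter fun f : G.edgeSet =>
        (f : Sym2 V) ∈ symmDiff (oddEdges b) J ∧ v ∈ (f : Sym2 V)).card := by
    symm
    refine Finset.card_bij (fun f _ => (f : Sym2 V))
      (fun f hf => Finset.mem_filter.2 (Finset.mem_filter.1 hf).2)
      (fun f _ g _ h => Subtype.ext h) fun f hf => ?_
    have hf' := Finset.mem_filter.1 hf
    exact ⟨⟨f, hsub f hf'.1⟩, Finset.mem_filter.2 ⟨Finset.mem_univ _, hf'⟩, rfl⟩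
  rw [← ZMod.natCast_eq_zero_iff_even, hcard, Finset.card_filter, Nat.cast_sum]
  have hzero : (Finsupp.linearCombination ℕ edgeClass b).2 v +
      (Finsupp.linearCombination ℕ edgeClass (edgeMonomial G J)).2 v = 0 := by
    rw [h]; exact CharTwo.add_self_eq_zero _
  rw [hcls, hcls, ← Finset.sum_add_distrib] at hzero
  rw [← hzero]
  refine Finset.sum_congr rfl fun f _ => ?_
  have hm : edgeMonomial G J f = if (f : Sym2 V) ∈ J then 1 else 0 := rfl
  simp only [← add_mul, hm, Finset.mem_symmDiff, mem_oddEdges]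
  by_cases hv : v ∈ (f : Sym2 V)
  · rcases Nat.even_or_odd (b f) with ho | ho
    · have h1 := (ZMod.natCast_eq_zero_iff_even).2 ho
      have h2 := Nat.not_odd_iff_even.2 ho
      by_cases hf : (f : Sym2 V) ∈ J <;> simp [hv, h1, h2, hf]
    · have h1 := (ZMod.natCast_eq_one_iff_odd).2 ho
      by_cases hf : (f : Sym2 V) ∈ J
      · simp only [hv, h1, ho, hf]
        decide
      · simp [hv, h1, ho, hf]
  · simp [hv]

open Classical in
/-- For a join `J` and `e ∈ J`, the squarefree monomial of `J \ e` is nonzero modulo the graph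
ideal and the variable of `e`. -/
lemma IsJoin.edgeMonomial_notMem [Finite V] {J : Finset (Sym2 V)} (hJ : IsJoin G J) (e : G.edgeSet)
    (he : (e : Sym2 V) ∈ J) :
    monomial (edgeMonomial G (J.erase e)) (1 : K) ∉ graphIdeal K G ⊔ Ideal.span {X e} := by
  cases nonempty_fintype G.edgeSet
  intro hmem
  have hJe : ((J.erase e : Finset (Sym2 V)) : Set (Sym2 V)) ⊆ G.edgeSet := fun f hf =>
    hJ.1 (Finset.mem_of_mem_erase hf)
  obtain ⟨g, hg, h, hh, hgh⟩ := Submodule.mem_sup.1 hmem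
  rw [mem_graphIdeal_iff] at hg
  have h1 : toricMap K edgeClass h =
      AddMonoidAlgebra.single (Finsupp.linearCombination ℕ edgeClass (edgeMonomial G (J.erase e)))
        1 := by
    rw [← toricMap_monomial, ← hgh, map_add, hg, zero_add]
  obtain ⟨b, hb, hbc⟩ := exists_mem_support_of_coeff_toricMap_ne_zero edgeClass h
    (Finsupp.linearCombination ℕ edgeClass (edgeMonomial G (J.erase e))) (by
      rw [h1, AddMonoidAlgebra.coeff_single, Finsupp.single_eq_same]
      exact one_ne_zero)
  have hbe : b e ≠ 0 := by
    rw [← Set.image_singleton, mem_ideal_span_X_image] at hh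
    obtain ⟨i, hi, h0⟩ := hh b hb
    rwa [Set.mem_singleton_iff.1 hi] at h0
  have hdeg : b.degree = (J.erase e).card := by
    have := congrArg Prod.fst hbc
    rw [linearCombination_edgeClass_fst, linearCombination_edgeClass_fst,
      degree_edgeMonomial hJe] at this
    omega
  have h2 := hJ.card_erase_le he (oddEdges_subset b) (isEvenSet_symmDiff hJe hbc)
  have h3 := card_oddEdges_add_le b e hbe
  -- Whether the exponent at `e` is odd (excess from the join inequality) or even (excess from `b`),
  -- the degree of `b` is at least |J \ e| + 2, contradicting `hdeg`.
  split_ifs at h2 h3 <;> omega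

end GraphSocle

/-! ### The regularity bound -/

section Regularity

/-- The Betti numbers are read off an arbitrarily chosen resolution, so asking for the bound in
every resolution avoids any appeal to uniqueness. -/
lemma le_regularity {σ K M : Type*} [Field K] [AddCommGroup M] [Module (MvPolynomial σ K) M]
    {ℳ : ℕ → AddSubgroup M} (hne : Nonempty (MinimalGradedFreeResolution (σ := σ) (K := K) ℳ))
    (n : ℕ) (h : ∀ F : MinimalGradedFreeResolution (σ := σ) (K := K) ℳ,
      ∃ i b, n + i ≤ F.deg i b) : (n : EReal) ≤ regularity σ K ℳ := by
  classical
  obtain ⟨i, b, hb⟩ := h (Classical.choice hne)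
  have hbetti : gradedBetti σ K ℳ i ((Classical.choice hne).deg i b) ≠ 0 := by
    rw [gradedBetti, dif_pos hne, MinimalGradedFreeResolution.betti]
    have : Nonempty {b' // (Classical.choice hne).deg i b' = (Classical.choice hne).deg i b} :=
      ⟨⟨b, rfl⟩⟩
    exact Nat.card_pos.ne'
  refine le_trans ?_ (le_iSup_of_le i (le_iSup_of_le _ (le_iSup_of_le hbetti le_rfl)))
  have h1 : (n : ℝ) ≤ ((Classical.choice hne).deg i b : ℝ) - i := by
    rw [le_sub_iff_add_le]
    exact_mod_cast hb
  exact_mod_cast EReal.coe_le_coe_iff.2 h1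

/-- Degree 0 generators are constants; a nonzero one would put 1 in the ideal, and if all vanish the
ideal is zero. This settles joins with at most one edge. -/
lemma exists_one_le_deg_zero {σ K : Type*} [Field K] {I : Ideal (MvPolynomial σ K)} (hI : I ≠ ⊥)
    (h1 : (1 : MvPolynomial σ K) ∉ I)
    (F : MinimalGradedFreeResolution (σ := σ) (K := K) (idealGrading I)) :
    ∃ b, 1 ≤ F.deg 0 b := by
  by_contra hcon
  push Not at hcon
  apply hI
  have hzero : ∀ b, F.ε (Pi.single b 1) = 0 := by
    intro b
    have hb := F.ε_deg b
    rw [Nat.lt_one_iff.1 (hcon b)] at hb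
    have hC : ((F.ε (Pi.single b 1) : I) : MvPolynomial σ K).IsHomogeneous 0 := hb
    have hC' := hC.totalDegree_le
    rw [Nat.le_zero, totalDegree_eq_zero_iff_eq_C] at hC'
    by_contra hne
    refine h1 ?_
    have hc : coeff 0 ((F.ε (Pi.single b 1) : I) : MvPolynomial σ K) ≠ 0 := by
      intro h0
      rw [h0, C_0] at hC'
      exact hne (Subtype.ext hC')
    have h2 := I.mul_mem_left (C (coeff 0 ((F.ε (Pi.single b 1) : I) : MvPolynomial σ K))⁻¹)
      (F.ε (Pi.single b 1)).2
    rw [hC', coeff_zero_C, ← C_mul, inv_mul_cancel₀ hc, C_1] at h2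
    exact h2
  have hε : F.ε = 0 := LinearMap.pi_ext' fun b => LinearMap.ext_ring (by simpa using hzero b)
  rw [Submodule.eq_bot_iff]
  intro x hx
  obtain ⟨v, hv⟩ := F.ε_surjective ⟨x, hx⟩
  rw [hε] at hv
  exact (congrArg Subtype.val hv).symm

lemma exists_isJoin_card_eq_maxJoinNumber {V : Type*} [Finite V] (G : SimpleGraph V) :
    ∃ J : Finset (Sym2 V), IsJoin G J ∧ J.card = maxJoinNumber G := by
  classical
  cases nonempty_fintype V
  refine Nat.sSup_mem (s := {k | ∃ J : Finset (Sym2 V), IsJoin G J ∧ J.card = k})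
    ⟨0, ∅, ⟨by simp, by simp⟩, rfl⟩ ⟨Fintype.card (Sym2 V), ?_⟩
  rintro _ ⟨J, -, rfl⟩
  exact J.card_le_univ

/-- A join with at least two edges bounds the regularity of the graph ideal from below. -/
lemma IsJoin.card_le_regularity {V K : Type*} [Field K] [Finite V] {G : SimpleGraph V}
    {J : Finset (Sym2 V)} (hJ : IsJoin G J) (hcard : 2 ≤ J.card) :
    (J.card : EReal) ≤ regularity G.edgeSet K (idealGrading (graphIdeal K G)) := by
  classical
  cases nonempty_fintype G.edgeSet
  refine le_regularity (nonempty_minimalGradedFreeResolution _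
    fun f hf j => homogeneousComponent_mem_graphIdeal hf j) _ fun F => ?_
  obtain ⟨e₀, he₀⟩ := Finset.card_pos.1 (by omega : 0 < J.card)
  let e : G.edgeSet := ⟨e₀, hJ.1 he₀⟩
  have hJe : ((J.erase e : Finset (Sym2 V)) : Set (Sym2 V)) ⊆ G.edgeSet := fun f hf =>
    hJ.1 (Finset.mem_of_mem_erase hf)
  obtain ⟨m, hdeg, hm₀, hm₁⟩ := exists_monomial_socle
    (Q := graphIdeal K G ⊔ Ideal.span {X e}) (fun l => by
      have h1 := Submodule.add_mem_sup (X_sq_sub_X_sq_mem_graphIdeal (K := K) l e)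
        (Ideal.pow_mem_of_mem _ (Ideal.mem_span_singleton_self (X e)) 2 two_pos)
      rwa [sub_add_cancel] at h1)
    _ (hJ.edgeMonomial_notMem (K := K) e he₀)
  rw [degree_edgeMonomial hJe, Finset.card_erase_of_mem he₀] at hdeg
  have hσ : J.card ≤ Fintype.card G.edgeSet := by
    rw [← Finset.card_univ, ← Finset.card_map ⟨Subtype.val, Subtype.val_injective⟩]
    exact Finset.card_le_card fun f hf =>
      Finset.mem_map.2 ⟨⟨f, hJ.1 hf⟩, Finset.mem_univ _, rfl⟩
  obtain ⟨k, hk⟩ := Nat.exists_eq_add_of_le' (hcard.trans hσ)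
  obtain ⟨b, hb⟩ := exists_deg_eq_of_socle F e (fun f hf => mem_graphIdeal_of_X_mul_mem e hf)
    m.degree (monomial m 1) (isHomogeneous_monomial 1 rfl) hm₀ hm₁ k hk
  -- The degree is `m.degree + (k + 1)` with `m.degree ≥ |J| - 1`, hence at least |J| + k.
  exact ⟨k, b, by omega⟩

lemma graphIdeal_ne_bot {V K : Type*} [Field K] [Finite V] {G : SimpleGraph V} {e f : G.edgeSet}
    (hef : e ≠ f) : graphIdeal K G ≠ ⊥ := by
  classical
  intro h
  have h1 := X_sq_sub_X_sq_mem_graphIdeal (K := K) e f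
  rw [h, Ideal.mem_bot, sub_eq_zero] at h1
  have h2 := congrArg (eval (Pi.single e (1 : K))) h1
  simp [hef.symm] at h2

end Regularity

end JoinReg

end

theorem mainTheorem2 {V : Type*} [Finite V] (K : Type*) [Field K] (G : SimpleGraph V)
    (hG : ∀ v : V, ∃ w : V, G.Adj v w) :
    (JoinReg.maxJoinNumber G : EReal) ≤ JoinReg.idealRegularity (JoinReg.graphIdeal K G) := by
  obtain ⟨J, hJ, hcard⟩ := JoinReg.exists_isJoin_card_eq_maxJoinNumber G
  rw [← hcard, JoinReg.idealRegularity]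
  by_cases h2 : 2 ≤ J.card
  · obtain ⟨a, ha, b, hb, hab⟩ := Finset.one_lt_card.1 h2
    rw [if_neg (JoinReg.graphIdeal_ne_bot (e := ⟨a, hJ.1 ha⟩) (f := ⟨b, hJ.1 hb⟩)
      fun h => hab (congrArg Subtype.val h))]
    exact hJ.card_le_regularity h2
  · have h1 : (J.card : EReal) ≤ ((1 : ℕ) : EReal) := by
      exact_mod_cast (by omega : J.card ≤ 1)
    refine h1.trans ?_
    split_ifs with hI
    -- For the zero ideal the bound is exactly the convention reg 0 = 1.
    · exact_mod_cast le_rfl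
    · refine JoinReg.le_regularity (JoinReg.nonempty_minimalGradedFreeResolution _
        fun f hf j => JoinReg.homogeneousComponent_mem_graphIdeal hf j) 1 fun F => ?_
      obtain ⟨b, hb⟩ := JoinReg.exists_one_le_deg_zero hI JoinReg.one_notMem_graphIdeal F
      exact ⟨0, b, hb⟩
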